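/- Let $G=(V,E)$ be a finite connected simple graph. Fix any orientation of its edges, let $\partial\in\mathbb Z^{V\times E}$ be the signed incidence matrix (the column of an edge has $-1$ in the row of its source, $+1$ in the row of its target and $0$ elsewhere), and let $\mathcal F(G)=\{x\in\mathbb Z^E:\partial x=0\}$ be the lattice of integral flows. Let $\mathbf f_1,\dots,\mathbf f_g$ be a $\mathbb Z$-basis of $\mathcal F(G)$, let $\iota$ be the $|E|\times g$ matrix with columns $\mathbf f_1,\dots,\mathbf f_g$, and let $\mathcal L^*=\iota^T\iota$ be the associated dual Laplacian. Suppose that $\{\mathbf f_1,\dots,\mathbf f_g\}$ is a cycle $M$-basis, that is, $\mathcal L^*$ is a (non-singular) $M$-matrix: $\mathcal L^*_{ij}\le 0$ for all $i\ne j$, and $\mathcal L^*$ is invertible over $\mathbb R$ with all entries of $(\mathcal L^*)^{-1}$ non-negative. Call $\mathbf c\in\mathbb Z^g$ a $z$-superstable cycle configuration (with respect to $\mathcal L^*$) if $\mathbf c\ge 0$ and for every $\mathbf z\in\mathbb Z^g$ with $\mathbf z\ge 0$ and $\mathbf z\ne\mathbf 0$ there is an index $i$ such that $c_i-(\mathcal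 L^*\mathbf z)_i<0$. Then the number of $z$-superstable cycle configurations is finite and equals the number of spanning trees of $G$. -/

import Mathlib

namespace CycleChipFiring

/-- An orientation of a simple graph: each edge is given a source and a target,
which are its two endpoints. -/
structure Orientation {V : Type*} (G : SimpleGraph V) where
  src : G.edgeSet → V
  tgt : G.edgeSet → V
  mk_src_tgt : ∀ e : G.edgeSet, s(src e, tgt e) = (e : Sym2 V)

/-- The signed incidence matrix `∂` of an oriented graph: the column of an edge has `-1` in the
row of its source, `1` in the row of its target and `0` elsewhere. -/
def Orientation.incidence {V : Type*} [DecidableEq V] {G : SimpleGraph V} (o : Orientation G) :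
    Matrix V G.edgeSet ℤ :=
  Matrix.of fun v e => if v = o.tgt e then 1 else if v = o.src e then -1 else 0

/-- The lattice of integral flows: the integer vectors in the kernel of `∂`. -/
def Orientation.flow {V : Type*} [DecidableEq V] {G : SimpleGraph V} [Fintype G.edgeSet]
    (o : Orientation G) : Submodule ℤ (G.edgeSet → ℤ) :=
  LinearMap.ker o.incidence.mulVecLin

section Basis

variable {V : Type*} [DecidableEq V] {G : SimpleGraph V} [Fintype G.edgeSet]
  {o : Orientation G} {g : ℕ}

/-- The `|E| × g` matrix `ι` whose columns are the basis elements. -/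
noncomputable def basisMatrix (f : Module.Basis (Fin g) ℤ o.flow) : Matrix G.edgeSet (Fin g) ℤ :=
  Matrix.of fun e i => (f i : G.edgeSet → ℤ) e

/-- The dual Laplacian `ιᵀ ι` of a basis of the lattice of integral flows. -/
noncomputable def dualLaplacian (f : Module.Basis (Fin g) ℤ o.flow) : Matrix (Fin g) (Fin g) ℤ :=
  (basisMatrix f).transpose * basisMatrix f

end Basis

/-- A Z-matrix: all off-diagonal entries are non-positive. -/
def IsZMatrix {n : ℕ} (L : Matrix (Fin n) (Fin n) ℝ) : Prop :=
  ∀ i j, i ≠ j → L i j ≤ 0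

/-- A (non-singular) M-matrix: an invertible Z-matrix whose inverse has non-negative entries. -/
def IsMMatrix {n : ℕ} (L : Matrix (Fin n) (Fin n) ℝ) : Prop :=
  IsZMatrix L ∧ IsUnit L.det ∧ ∀ i j, 0 ≤ L⁻¹ i j

/-- A basis of the lattice of integral flows is a cycle M-basis if its dual Laplacian,
viewed as a real matrix, is an M-matrix. -/
def IsCycleMBasis {V : Type*} [DecidableEq V] {G : SimpleGraph V} [Fintype G.edgeSet]
    {o : Orientation G} {g : ℕ} (f : Module.Basis (Fin g) ℤ o.flow) : Prop :=
  IsMMatrix ((dualLaplacian f).map (Int.cast : ℤ → ℝ))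

/-- A configuration `c ∈ ℤⁿ` is z-superstable with respect to `L` if `c ≥ 0` and firing any
nonzero multiset `z` of sites makes some site negative. -/
def IsZSuperstable {n : ℕ} (L : Matrix (Fin n) (Fin n) ℤ) (c : Fin n → ℤ) : Prop :=
  0 ≤ c ∧ ∀ z : Fin n → ℤ, 0 ≤ z → z ≠ 0 → ∃ i, c i - L.mulVec z i < 0

/-- The set of spanning trees of `G`: the trees on all of `V` all of whose edges are
edges of `G`. -/
def spanningTrees {V : Type*} (G : SimpleGraph V) : Set (SimpleGraph V) :=
  {T | T ≤ G ∧ T.IsTree}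

end CycleChipFiring

/-!
For a Z-matrix `L` the set `{w | L w ≤ c}` is closed under suprema, and inverse-positivity bounds it
above, so it has exactly one maximal element. Since `c - L w` is z-superstable precisely when `w` is
maximal in this set, every coset of the image of `L` contains exactly one z-superstable
configuration, and there are `|det L|` of them.

For the dual Laplacian, Cauchy–Binet expresses the determinant as a sum over the sets `S` of `g`
edges of the Gram determinant of the restriction of flows to `S`. If `S` is the complement of a
spanning tree, flows restrict isomorphically to `S` and the summand is `1`. If the summand is
nonzero, no nonzero flow is supported off `S`, so the complement of `S` is a forest, hence by
cardinality a spanning tree.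
-/

namespace CycleChipFiring

open Matrix

section Superstable

section ZMatrix

variable {ι R : Type*} [Fintype ι] [CommRing R] [LinearOrder R] [IsOrderedRing R]
  {L : Matrix ι ι R}

lemma mulVec_apply_le_of_le_of_apply_eq (hL : ∀ i j, i ≠ j → L i j ≤ 0) {u v : ι → R}
    (huv : u ≤ v) {i : ι} (hi : u i = v i) : (L *ᵥ v) i ≤ (L *ᵥ u) i := by
  refine Finset.sum_le_sum fun j _ => ?_
  obtain rfl | hij := eq_or_ne i j
  · rw [hi]
  · exact mul_le_mul_of_nonpos_left (huv j) (hL i j hij)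

lemma mulVec_sup_le (hL : ∀ i j, i ≠ j → L i j ≤ 0) (u v : ι → R) :
    L *ᵥ (u ⊔ v) ≤ L *ᵥ u ⊔ L *ᵥ v := by
  intro i
  obtain hi | hi := le_total (v i) (u i)
  · exact (mulVec_apply_le_of_le_of_apply_eq hL le_sup_left (sup_eq_left.mpr hi).symm).trans
      le_sup_left
  · exact (mulVec_apply_le_of_le_of_apply_eq hL le_sup_right (sup_eq_right.mpr hi).symm).trans
      le_sup_right

lemma supClosed_setOf_mulVec_le (hL : ∀ i j, i ≠ j → L i j ≤ 0) (c : ι → R) :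
    SupClosed {w | L *ᵥ w ≤ c} :=
  fun u hu v hv => (mulVec_sup_le hL u v).trans (sup_le hu hv)

end ZMatrix

lemma exists_le_mulVec {ι : Type*} [Fintype ι] [DecidableEq ι] {L : Matrix ι ι ℤ}
    (hL : L.det ≠ 0) (c : ι → ℤ) : ∃ w, c ≤ L *ᵥ w := by
  refine ⟨L.adjugate *ᵥ (L.det • |c|), fun i => ?_⟩
  have hdet : 1 ≤ L.det * L.det := Int.add_one_le_iff.mpr (mul_self_pos.mpr hL)
  calc c i ≤ |c i| := le_abs_self _
    _ ≤ L.det * L.det * |c i| := le_mul_of_one_le_left (abs_nonneg _) hdet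
    _ = (L *ᵥ L.adjugate *ᵥ (L.det • |c|)) i := by
      simp [mulVec_mulVec, mul_adjugate, mul_assoc]

lemma exists_maximal_of_bddAbove {α : Type*} [Preorder α] [LocallyFiniteOrder α] {s : Set α}
    (hne : s.Nonempty) (hs : BddAbove s) : ∃ m, Maximal (· ∈ s) m := by
  obtain ⟨a, ha⟩ := hne
  have hfin : (s ∩ Set.Ici a).Finite :=
    (bddBelow_Ici.mono Set.inter_subset_right).finite_of_bddAbove (hs.mono Set.inter_subset_left)
  obtain ⟨m, ham, hm⟩ := hfin.exists_le_maximal ⟨ha, le_rfl⟩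
  exact ⟨m, hm.prop.1, fun b hb hmb => hm.le_of_ge ⟨hb, ham.trans hmb⟩ hmb⟩

variable {n : ℕ}

lemma isZSuperstable_sub_mulVec_iff {L : Matrix (Fin n) (Fin n) ℤ} {c w : Fin n → ℤ} :
    IsZSuperstable L (c - L *ᵥ w) ↔ Maximal (fun u => L *ᵥ u ≤ c) w := by
  refine and_congr sub_nonneg ⟨fun h u hu hwu => ?_, fun h z hz hz0 => ?_⟩
  · by_contra hne
    obtain ⟨i, hi⟩ := h (u - w) (sub_nonneg.mpr hwu) fun h0 => hne (sub_eq_zero.mp h0).le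
    have hui : (L *ᵥ u) i ≤ c i := hu i
    rw [mulVec_sub, Pi.sub_apply, Pi.sub_apply] at hi
    linarith
  · by_contra! hfire
    have hwz : L *ᵥ (w + z) ≤ c := fun i => by
      have hi := hfire i
      rw [Pi.sub_apply] at hi
      rw [mulVec_add, Pi.add_apply]
      linarith
    have hzw : w + z ≤ w := h hwz (le_add_of_nonneg_right hz)
    exact hz0 (le_antisymm (by simpa using hzw) hz)

lemma IsMMatrix.le_of_mulVec_le_mulVec {L : Matrix (Fin n) (Fin n) ℝ} (hL : IsMMatrix L)
    {u v : Fin n → ℝ} (huv : L *ᵥ u ≤ L *ᵥ v) : u ≤ v := by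
  have hinv (w : Fin n → ℝ) : L⁻¹ *ᵥ L *ᵥ w = w := by
    rw [mulVec_mulVec, nonsing_inv_mul _ hL.2.1, one_mulVec]
  rw [← hinv u, ← hinv v]
  exact fun i => dotProduct_le_dotProduct_of_nonneg_left huv (hL.2.2 i)

section IntMMatrix

variable {L : Matrix (Fin n) (Fin n) ℤ} (hL : IsMMatrix (L.map (Int.cast : ℤ → ℝ)))
include hL

lemma IsMMatrix.int_apply_nonpos {i j : Fin n} (hij : i ≠ j) : L i j ≤ 0 := by
  simpa using hL.1 i j hij

lemma IsMMatrix.int_det_ne_zero : L.det ≠ 0 := by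
  have hdet : ((L.det : ℤ) : ℝ) ≠ 0 := by
    rw [Int.cast_det]
    exact hL.2.1.ne_zero
  exact_mod_cast hdet

lemma IsMMatrix.int_le_of_mulVec_le_mulVec {u v : Fin n → ℤ} (huv : L *ᵥ u ≤ L *ᵥ v) :
    u ≤ v := by
  have hcast (w : Fin n → ℤ) (i : Fin n) :
      (L.map (Int.cast : ℤ → ℝ) *ᵥ fun j => (w j : ℝ)) i = ((L *ᵥ w) i : ℝ) :=
    ((Int.castRingHom ℝ).map_mulVec L w i).symm
  have hle := hL.le_of_mulVec_le_mulVec (u := fun j => (u j : ℝ)) (v := fun j => (v j : ℝ))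
    fun i => by rw [hcast, hcast]; exact Int.cast_le.mpr (huv i)
  exact fun i => Int.cast_le.mp (hle i)

lemma IsMMatrix.exists_maximal_mulVec_le (c : Fin n → ℤ) :
    ∃ w, Maximal (fun u => L *ᵥ u ≤ c) w := by
  obtain ⟨a, ha⟩ := exists_le_mulVec hL.int_det_ne_zero (-c)
  obtain ⟨b, hb⟩ := exists_le_mulVec hL.int_det_ne_zero c
  refine exists_maximal_of_bddAbove (s := {u | L *ᵥ u ≤ c}) ⟨-a, ?_⟩
    ⟨b, fun u hu => hL.int_le_of_mulVec_le_mulVec (hu.trans hb)⟩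
  change L *ᵥ (-a) ≤ c
  rw [mulVec_neg]
  exact neg_le.mp ha

theorem IsMMatrix.existsUnique_isZSuperstable_sub_mulVec (c : Fin n → ℤ) :
    ∃! w, IsZSuperstable L (c - L *ᵥ w) := by
  simp only [isZSuperstable_sub_mulVec_iff]
  refine existsUnique_of_exists_of_unique (hL.exists_maximal_mulVec_le c) fun u v hu hv => ?_
  have hsup : L *ᵥ (u ⊔ v) ≤ c :=
    supClosed_setOf_mulVec_le (fun _ _ => hL.int_apply_nonpos) c hu.prop hv.prop
  exact (hu.eq_of_le hsup le_sup_left).trans (hv.eq_of_le hsup le_sup_right).symm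

lemma IsMMatrix.bijOn_mkQ_isZSuperstable :
    Set.BijOn (LinearMap.range L.mulVecLin).mkQ {c | IsZSuperstable L c} Set.univ := by
  refine ⟨Set.mapsTo_univ _ _, fun c hc d hd hcd => ?_, fun q _ => ?_⟩
  · obtain ⟨w, hw : L *ᵥ w = c - d⟩ := (Submodule.Quotient.eq _).mp hcd
    have hw0 : w = 0 := (hL.existsUnique_isZSuperstable_sub_mulVec c).unique
      (by rwa [hw, sub_sub_cancel]) (by rwa [mulVec_zero, sub_zero])
    rwa [hw0, mulVec_zero, eq_comm, sub_eq_zero] at hw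
  · obtain ⟨c, rfl⟩ := Submodule.mkQ_surjective _ q
    obtain ⟨w, hw, -⟩ := hL.existsUnique_isZSuperstable_sub_mulVec c
    refine ⟨_, hw, (Submodule.Quotient.eq _).mpr ⟨-w, ?_⟩⟩
    rw [mulVecLin_apply, mulVec_neg, sub_sub_cancel_left]

end IntMMatrix

lemma natCard_quotient_range_mulVecLin {ι : Type*} [Fintype ι] [DecidableEq ι]
    {L : Matrix ι ι ℤ} (hL : L.det ≠ 0) :
    Nat.card ((ι → ℤ) ⧸ LinearMap.range L.mulVecLin) = L.det.natAbs := by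
  have hinj : Function.Injective L.mulVecLin :=
    (injective_iff_map_eq_zero _).mpr fun _ hv => eq_zero_of_mulVec_eq_zero hL hv
  rw [← Submodule.natAbs_det_basis_change (Pi.basisFun ℤ ι) _
    ((Pi.basisFun ℤ ι).map (LinearEquiv.ofInjective _ hinj)), Pi.basisFun_det_apply,
    ← det_transpose]
  congr 2
  ext i j
  simp

theorem IsMMatrix.encard_setOf_isZSuperstable {L : Matrix (Fin n) (Fin n) ℤ}
    (hL : IsMMatrix (L.map (Int.cast : ℤ → ℝ))) :
    {c | IsZSuperstable L c}.encard = L.det.natAbs := by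
  have hbij := hL.bijOn_mkQ_isZSuperstable
  have hcard := natCard_quotient_range_mulVecLin hL.int_det_ne_zero
  have : Finite ((Fin n → ℤ) ⧸ LinearMap.range L.mulVecLin) :=
    Nat.finite_of_card_ne_zero (hcard ▸ Int.natAbs_ne_zero.mpr hL.int_det_ne_zero)
  rw [← hbij.injOn.encard_image, hbij.image_eq, Set.encard_univ, ENat.card_eq_coe_natCard, hcard]

end Superstable

section CauchyBinet

variable {ι E R : Type*} [Fintype ι]

lemma filter_powersetCard_eq_singleton_of_injective [Fintype E] [DecidableEq E] {p : ι → E}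
    (hp : p.Injective) :
    {S ∈ (Finset.univ : Finset E).powersetCard (Fintype.card ι) | ∀ i, p i ∈ S} =
      {Finset.univ.image p} := by
  have hcard : (Finset.univ.image p).card = Fintype.card ι :=
    Finset.card_image_of_injective _ hp
  ext S
  simp only [Finset.mem_filter, Finset.mem_powersetCard_univ, Finset.mem_singleton]
  constructor
  · rintro ⟨hS, hpS⟩
    refine (Finset.eq_of_subset_of_card_le ?_ (hS.trans hcard.symm).le).symm
    simpa [Finset.subset_iff] using hpS
  · rintro rfl
    exact ⟨hcard, fun i => Finset.mem_image_of_mem p (Finset.mem_univ i)⟩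

variable [DecidableEq ι] [CommRing R]

lemma det_sum_mul_eq_sum_piFinset (A : Matrix ι E R) (B : Matrix E ι R)
    (S : Finset E) :
    (of fun i k => ∑ e ∈ S, A i e * B e k).det =
      ∑ p ∈ Fintype.piFinset fun _ : ι => S, (∏ i, A i (p i)) * (B.submatrix p id).det := by
  have hrows : (of fun i k => ∑ e ∈ S, A i e * B e k) = fun i => ∑ e ∈ S, A i e • B e := by
    ext i k
    simp
  rw [hrows]
  refine (detRowAlternating.toMultilinearMap.map_sum_finset (fun i e => A i e • B e)
    fun _ => S).trans (Finset.sum_congr rfl fun p _ => ?_)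
  exact detRowAlternating.toMultilinearMap.map_smul_univ _ _

/-- The Cauchy–Binet formula. Taking the determinant of the product of the two submatrices, instead
of the product of two minors, avoids choosing an enumeration of `S`. -/
theorem det_mul_eq_sum_powersetCard [Fintype E] (A : Matrix ι E R) (B : Matrix E ι R) :
    (A * B).det = ∑ S ∈ (Finset.univ : Finset E).powersetCard (Fintype.card ι),
      (A.submatrix id ((↑) : S → E) * B.submatrix ((↑) : S → E) id).det := by
  classical
  let term (p : ι → E) : R := (∏ i, A i (p i)) * (B.submatrix p id).det
  have hterm (p : ι → E) :
      ∑ S ∈ (Finset.univ : Finset E).powersetCard (Fintype.card ι) with ∀ i, p i ∈ S, term p =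
        term p := by
    by_cases hp : p.Injective
    · rw [filter_powersetCard_eq_singleton_of_injective hp, Finset.sum_singleton]
    · obtain ⟨i, j, hpij, hij⟩ := Function.not_injective_iff.mp hp
      have hdet : (B.submatrix p id).det = 0 := det_zero_of_row_eq hij (by ext; simp [hpij])
      simp [term, hdet]
  calc (A * B).det = ∑ p, term p := by
        rw [← Fintype.piFinset_univ, ← det_sum_mul_eq_sum_piFinset]
        rfl
    _ = ∑ p, ∑ S ∈ (Finset.univ : Finset E).powersetCard (Fintype.card ι) with ∀ i, p i ∈ S,
          term p := (Finset.sum_congr rfl fun p _ => hterm p).symm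
    _ = ∑ S ∈ (Finset.univ : Finset E).powersetCard (Fintype.card ι),
          ∑ p ∈ Fintype.piFinset fun _ => S, term p :=
        Finset.sum_comm' (by simp [and_comm])
    _ = _ := Finset.sum_congr rfl fun S _ => by
        rw [← det_sum_mul_eq_sum_piFinset]
        congr 1
        ext i k
        exact (Finset.sum_coe_sort S fun e => A i e * B e k).symm

end CauchyBinet

section Gram

variable {ι κ R M N : Type*} [Fintype ι] [DecidableEq ι] [Fintype κ] [CommRing R]
  [AddCommGroup M] [AddCommGroup N]

lemma det_transpose_mul_self_eq_sq (e : ι ≃ κ) (A : Matrix κ ι R) :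
    (Aᵀ * A).det = (A.submatrix e id).det ^ 2 := by
  rw [← submatrix_id_id (Aᵀ * A), ← submatrix_mul_equiv Aᵀ A id e id, det_mul, sq,
    ← transpose_submatrix, det_transpose]

lemma det_gram_toMatrix_linearEquiv (b : Module.Basis ι ℤ M)
    (c : Module.Basis κ ℤ N) (φ : M ≃ₗ[ℤ] N) :
    ((LinearMap.toMatrix b c φ)ᵀ * LinearMap.toMatrix b c φ).det = 1 := by
  let e : ι ≃ κ := b.indexEquiv (c.map φ.symm)
  have hreindex : (LinearMap.toMatrix b c φ).submatrix e id =
      LinearMap.toMatrix b (c.reindex e.symm) φ := by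
    ext i j
    simp [LinearMap.toMatrix_apply]
  rw [det_transpose_mul_self_eq_sq e, hreindex]
  exact Int.isUnit_sq (φ.isUnit_det b (c.reindex e.symm))

lemma injective_of_det_gram_toMatrix_ne_zero [IsDomain R] [Module R M] [Module R N]
    (b : Module.Basis ι R M) (c : Module.Basis κ R N) (φ : M →ₗ[R] N)
    (h : ((LinearMap.toMatrix b c φ)ᵀ * LinearMap.toMatrix b c φ).det ≠ 0) :
    Function.Injective φ := by
  refine (injective_iff_map_eq_zero φ).mpr fun x hx => ?_
  have hrepr : LinearMap.toMatrix b c φ *ᵥ b.repr x = 0 := by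
    rw [LinearMap.toMatrix_mulVec_repr, hx, map_zero, Finsupp.coe_zero]
  have hcoord : ⇑(b.repr x) = 0 := eq_zero_of_mulVec_eq_zero h (by
    rw [← mulVec_mulVec, hrepr, mulVec_zero])
  exact b.repr.map_eq_zero_iff.mp (DFunLike.coe_injective hcoord)

end Gram

section Flow

variable {V : Type*} {G H K T : SimpleGraph V}

section Coedges

open scoped Classical in
/-- The edges of `G` that are not edges of `H`; for a spanning tree, its cotree. -/
noncomputable def coedgeFinset (G : SimpleGraph V) [Fintype G.edgeSet] (H : SimpleGraph V) :
    Finset G.edgeSet := {e | (e : Sym2 V) ∉ H.edgeSet}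

variable [Fintype G.edgeSet]

@[simp]
lemma mem_coedgeFinset {e : G.edgeSet} : e ∈ coedgeFinset G H ↔ (e : Sym2 V) ∉ H.edgeSet := by
  simp [coedgeFinset]

lemma coedgeFinset_subset_coedgeFinset_iff (hH : H ≤ G) :
    coedgeFinset G K ⊆ coedgeFinset G H ↔ H ≤ K := by
  rw [← SimpleGraph.edgeSet_subset_edgeSet]
  refine ⟨fun h e he => ?_, fun h e he => ?_⟩
  · by_contra heK
    lift e to G.edgeSet using SimpleGraph.edgeSet_mono hH he
    exact mem_coedgeFinset.mp (h (mem_coedgeFinset.mpr heK)) he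
  · exact mem_coedgeFinset.mpr fun heH => mem_coedgeFinset.mp he (h heH)

lemma injOn_coedgeFinset : Set.InjOn (coedgeFinset G) {H | H ≤ G} :=
  fun _ hH _ hK h => le_antisymm ((coedgeFinset_subset_coedgeFinset_iff hH).mp h.superset)
    ((coedgeFinset_subset_coedgeFinset_iff hK).mp h.subset)

lemma coedgeFinset_deleteEdges (S : Finset G.edgeSet) :
    coedgeFinset G (G.deleteEdges ((↑) '' (S : Set G.edgeSet))) = S := by
  ext e
  simp [SimpleGraph.edgeSet_deleteEdges]

variable (G H) in
/-- The integral `1`-chains of `G` supported on the edges of the subgraph `H`, as the kernel of the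
restriction to the remaining edges. -/
noncomputable def chainsOn : Submodule ℤ (G.edgeSet → ℤ) :=
  LinearMap.ker (LinearMap.funLeft ℤ ℤ ((↑) : coedgeFinset G H → G.edgeSet))

lemma mem_chainsOn {x : G.edgeSet → ℤ} :
    x ∈ chainsOn G H ↔ ∀ e : G.edgeSet, (e : Sym2 V) ∉ H.edgeSet → x e = 0 := by
  simp [chainsOn, funext_iff, LinearMap.funLeft_apply]

lemma chainsOn_mono (h : H ≤ K) : chainsOn G H ≤ chainsOn G K := fun _ hx =>
  mem_chainsOn.mpr fun e he => mem_chainsOn.mp hx e fun heH => he (SimpleGraph.edgeSet_mono h heH)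

lemma single_mem_chainsOn [DecidableEq G.edgeSet] {e : G.edgeSet} (he : (e : Sym2 V) ∈ H.edgeSet)
    (a : ℤ) : Pi.single e a ∈ chainsOn G H :=
  mem_chainsOn.mpr fun e' he' => Pi.single_eq_of_ne (fun h : e' = e => he' (h ▸ he)) _

end Coedges

namespace Orientation

variable (o : Orientation G)

lemma tgt_ne_src (e : G.edgeSet) : o.tgt e ≠ o.src e := by
  intro h
  have he : s(o.src e, o.tgt e) ∈ G.edgeSet := (o.mk_src_tgt e).symm ▸ e.2
  exact G.ne_of_adj ((SimpleGraph.mem_edgeSet G).mp he) h.symm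

variable [DecidableEq V]

lemma col_incidence (e : G.edgeSet) :
    o.incidence.col e = Pi.single (o.tgt e) 1 - Pi.single (o.src e) 1 := by
  have hne := o.tgt_ne_src e
  ext v
  simp only [incidence, col_apply, of_apply, Pi.sub_apply, Pi.single_apply]
  split_ifs <;> simp_all

lemma vecMul_incidence_apply [Fintype V] (y : V → ℤ) (e : G.edgeSet) :
    (y ᵥ* o.incidence) e = y (o.tgt e) - y (o.src e) := by
  change y ⬝ᵥ o.incidence.col e = _
  rw [col_incidence, dotProduct_sub, dotProduct_single_one, dotProduct_single_one]

variable [Fintype G.edgeSet]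

lemma vecMul_incidence_dotProduct_eq_zero [Fintype V] {x : G.edgeSet → ℤ} (hx : x ∈ o.flow)
    (y : V → ℤ) : (y ᵥ* o.incidence) ⬝ᵥ x = 0 := by
  rw [← dotProduct_mulVec, show o.incidence *ᵥ x = 0 from hx, dotProduct_zero]

lemma incidence_mulVecLin_single [DecidableEq G.edgeSet] (e : G.edgeSet) :
    o.incidence.mulVecLin (Pi.single e 1) =
      Pi.single (o.tgt e) 1 - Pi.single (o.src e) 1 := by
  rw [mulVecLin_apply, mulVec_single_one, col_incidence]

lemma single_sub_single_mem_map_chainsOn_of_adj (hH : H ≤ G) {u v : V} (huv : H.Adj u v) :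
    (Pi.single v 1 - Pi.single u 1 : V → ℤ) ∈ (chainsOn G H).map o.incidence.mulVecLin := by
  classical
  let e : G.edgeSet := ⟨s(u, v), hH huv⟩
  have hmem : (Pi.single (o.tgt e) 1 - Pi.single (o.src e) 1 : V → ℤ) ∈
      (chainsOn G H).map o.incidence.mulVecLin :=
    ⟨Pi.single e 1, single_mem_chainsOn (e := e) huv 1, o.incidence_mulVecLin_single e⟩
  obtain ⟨hsrc, htgt⟩ | ⟨hsrc, htgt⟩ := Sym2.eq_iff.mp (o.mk_src_tgt e)
  · rwa [hsrc, htgt] at hmem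
  · rw [← neg_sub]
    rw [hsrc, htgt] at hmem
    exact neg_mem hmem

lemma single_sub_single_mem_map_chainsOn_of_reachable (hH : H ≤ G) {u v : V}
    (huv : H.Reachable u v) :
    (Pi.single v 1 - Pi.single u 1 : V → ℤ) ∈ (chainsOn G H).map o.incidence.mulVecLin := by
  obtain ⟨p⟩ := huv
  induction p with
  | nil => rw [sub_self]; exact zero_mem _
  | @cons u w v huw _ ih =>
    rw [← sub_add_sub_cancel _ (Pi.single w 1)]
    exact add_mem ih (o.single_sub_single_mem_map_chainsOn_of_adj hH huw)

lemma codisjoint_flow_chainsOn (hH : H ≤ G) (hconn : H.Preconnected) :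
    Codisjoint o.flow (chainsOn G H) := by
  classical
  have hmap : (⊤ : Submodule ℤ (G.edgeSet → ℤ)).map o.incidence.mulVecLin ≤
      (chainsOn G H).map o.incidence.mulVecLin := by
    rw [← (Pi.basisFun ℤ G.edgeSet).span_eq, Submodule.map_span_le]
    rintro _ ⟨e, rfl⟩
    rw [Pi.basisFun_apply, incidence_mulVecLin_single]
    exact o.single_sub_single_mem_map_chainsOn_of_reachable hH (hconn _ _)
  rw [codisjoint_comm, codisjoint_iff_le_sup]
  exact (LinearMap.map_le_map_iff _).mp hmap

lemma isAcyclic_of_disjoint_flow_chainsOn (hH : H ≤ G) (h : Disjoint o.flow (chainsOn G H)) :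
    H.IsAcyclic := by
  classical
  refine SimpleGraph.isAcyclic_iff_forall_isBridge.mpr fun e he => ?_
  lift e to G.edgeSet using SimpleGraph.edgeSet_mono hH he
  have hle : H.deleteEdges {(e : Sym2 V)} ≤ H := SimpleGraph.deleteEdges_le _
  rw [← o.mk_src_tgt e, SimpleGraph.isBridge_iff, o.mk_src_tgt e]
  intro hreach
  obtain ⟨y, hy, hye⟩ :=
    o.single_sub_single_mem_map_chainsOn_of_reachable (hle.trans hH) hreach
  have hflow : Pi.single e 1 - y ∈ o.flow := by
    rw [flow, LinearMap.sub_mem_ker_iff, hye, incidence_mulVecLin_single]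
  have hzero : Pi.single e 1 - y = 0 := Submodule.disjoint_def.mp h _ hflow
    (sub_mem (single_mem_chainsOn he 1) (chainsOn_mono hle hy))
  have hye0 : y e = 0 := mem_chainsOn.mp hy e (by simp)
  simpa [hye0] using congrFun hzero e

lemma disjoint_flow_chainsOn_of_isAcyclic [Finite V] (hH : H.IsAcyclic) :
    Disjoint o.flow (chainsOn G H) := by
  have := Fintype.ofFinite V
  classical
  refine Submodule.disjoint_def.mpr fun x hflow hx => funext fun e => ?_
  by_cases he : (e : Sym2 V) ∈ H.edgeSet
  swap
  · exact mem_chainsOn.mp hx e he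
  set C := H.deleteEdges {(e : Sym2 V)}
  have hbridge : ¬ C.Reachable (o.src e) (o.tgt e) := by
    have h := SimpleGraph.isAcyclic_iff_forall_isBridge.mp hH he
    rwa [← o.mk_src_tgt e, SimpleGraph.isBridge_iff, o.mk_src_tgt e] at h
  -- The cut around the component of `src e` in `H - e` meets the support of `x` at most in `e`.
  let y : V → ℤ := fun v => if C.Reachable (o.src e) v then 1 else 0
  have hcut (e' : G.edgeSet) (hne : e' ≠ e) (he' : (e' : Sym2 V) ∈ H.edgeSet) :
      y (o.tgt e') = y (o.src e') := by
    have hadj : C.Adj (o.src e') (o.tgt e') := by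
      rw [← SimpleGraph.mem_edgeSet, o.mk_src_tgt, SimpleGraph.edgeSet_deleteEdges]
      exact ⟨he', fun h => hne (Subtype.ext h)⟩
    have hiff : C.Reachable (o.src e) (o.tgt e') ↔ C.Reachable (o.src e) (o.src e') :=
      ⟨fun h => h.trans hadj.reachable.symm, fun h => h.trans hadj.reachable⟩
    simp only [y, hiff]
  have hsum : (y ᵥ* o.incidence) ⬝ᵥ x = (y ᵥ* o.incidence) e * x e := by
    refine Fintype.sum_eq_single e fun e' hne => ?_
    by_cases he' : (e' : Sym2 V) ∈ H.edgeSet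
    · rw [o.vecMul_incidence_apply, hcut e' hne he', sub_self, zero_mul]
    · rw [mem_chainsOn.mp hx e' he', mul_zero]
  rw [o.vecMul_incidence_dotProduct_eq_zero hflow, o.vecMul_incidence_apply] at hsum
  simpa [y, hbridge] using hsum

/-- The restriction of flows to the edges in `S`; when `S` is a cotree this is an isomorphism, so
flows are given by arbitrary values on the cotree. -/
noncomputable def flowRestrict (S : Finset G.edgeSet) : o.flow →ₗ[ℤ] (S → ℤ) :=
  (LinearMap.funLeft ℤ ℤ ((↑) : S → G.edgeSet)).domRestrict o.flow

lemma injective_flowRestrict_coedgeFinset_iff :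
    Function.Injective (o.flowRestrict (coedgeFinset G H)) ↔ Disjoint o.flow (chainsOn G H) :=
  LinearMap.injective_domRestrict_iff

lemma bijective_flowRestrict_coedgeFinset [Finite V] (hT : T ∈ spanningTrees G) :
    Function.Bijective (o.flowRestrict (coedgeFinset G T)) := by
  refine ⟨o.injective_flowRestrict_coedgeFinset_iff.mpr
    (o.disjoint_flow_chainsOn_of_isAcyclic hT.2.isAcyclic), ?_⟩
  exact (LinearMap.surjective_domRestrict_iff
    (LinearMap.funLeft_surjective_of_injective _ _ _ Subtype.val_injective)).mpr
    (o.codisjoint_flow_chainsOn hT.1 hT.2.connected.preconnected)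

end Orientation

variable [DecidableEq V] [Fintype G.edgeSet] {o : Orientation G} {g : ℕ}
  (f : Module.Basis (Fin g) ℤ o.flow)

/-- The Gram determinant of the rows of the basis matrix indexed by `S`. When `S` has `g` elements
it is the square of the maximal minor with these rows. -/
noncomputable def gramMinor (S : Finset G.edgeSet) : ℤ :=
  ((LinearMap.toMatrix f (Pi.basisFun ℤ S) (o.flowRestrict S))ᵀ *
    LinearMap.toMatrix f (Pi.basisFun ℤ S) (o.flowRestrict S)).det

lemma det_dualLaplacian_eq_sum_gramMinor :
    (dualLaplacian f).det = ∑ S ∈ Finset.univ.powersetCard g, gramMinor f S := by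
  have hrestrict (S : Finset G.edgeSet) :
      LinearMap.toMatrix f (Pi.basisFun ℤ S) (o.flowRestrict S) =
        (basisMatrix f).submatrix ((↑) : S → G.edgeSet) id := by
    ext e i
    simp [LinearMap.toMatrix_apply, basisMatrix, Orientation.flowRestrict, LinearMap.funLeft_apply]
  rw [dualLaplacian, det_mul_eq_sum_powersetCard, Fintype.card_fin]
  exact Finset.sum_congr rfl fun S _ => by rw [gramMinor, hrestrict, transpose_submatrix]

section SpanningTree

variable [Finite V]

include f in
lemma card_coedgeFinset (hT : T ∈ spanningTrees G) : (coedgeFinset G T).card = g := by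
  have hrank :=
    (LinearEquiv.ofBijective _ (o.bijective_flowRestrict_coedgeFinset hT)).finrank_eq
  rw [Module.finrank_eq_card_basis f, Module.finrank_fintype_fun_eq_card, Fintype.card_fin,
    Fintype.card_coe] at hrank
  exact hrank.symm

lemma gramMinor_coedgeFinset (hT : T ∈ spanningTrees G) :
    gramMinor f (coedgeFinset G T) = 1 :=
  det_gram_toMatrix_linearEquiv f (Pi.basisFun ℤ _)
    (LinearEquiv.ofBijective _ (o.bijective_flowRestrict_coedgeFinset hT))

lemma exists_coedgeFinset_eq_of_gramMinor_ne_zero (hG : G.Connected) {S : Finset G.edgeSet}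
    (hS : S.card = g) (h : gramMinor f S ≠ 0) :
    ∃ T ∈ spanningTrees G, coedgeFinset G T = S := by
  obtain ⟨H, hH, rfl⟩ : ∃ H ≤ G, coedgeFinset G H = S :=
    ⟨_, SimpleGraph.deleteEdges_le _, coedgeFinset_deleteEdges S⟩
  have hacyclic : H.IsAcyclic := o.isAcyclic_of_disjoint_flow_chainsOn hH <|
    o.injective_flowRestrict_coedgeFinset_iff.mp <|
      injective_of_det_gram_toMatrix_ne_zero f (Pi.basisFun ℤ _) _ h
  obtain ⟨T, hHT, hTG, hT⟩ := hG.exists_isTree_le_of_le_of_isAcyclic hH hacyclic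
  exact ⟨T, ⟨hTG, hT⟩, Finset.eq_of_subset_of_card_le
    ((coedgeFinset_subset_coedgeFinset_iff hH).mpr hHT)
    (hS.trans (card_coedgeFinset f ⟨hTG, hT⟩).symm).le⟩

theorem det_dualLaplacian (hG : G.Connected) :
    (dualLaplacian f).det = (spanningTrees G).ncard := by
  have hsum : ∑ _T ∈ (spanningTrees G).toFinite.toFinset, (1 : ℤ) =
      ∑ S ∈ Finset.univ.powersetCard g, gramMinor f S := by
    refine Finset.sum_of_injOn (coedgeFinset G) ?_ ?_ ?_ ?_
    · exact injOn_coedgeFinset.mono fun T hT => ((Set.Finite.mem_toFinset _).mp hT).1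
    · exact fun T hT => Finset.mem_powersetCard_univ.mpr
        (card_coedgeFinset f ((Set.Finite.mem_toFinset _).mp hT))
    · refine fun S hS hne => by_contra fun h => hne ?_
      obtain ⟨T, hT, rfl⟩ := exists_coedgeFinset_eq_of_gramMinor_ne_zero f hG
        (Finset.mem_powersetCard_univ.mp hS) h
      exact ⟨T, (Set.Finite.mem_toFinset _).mpr hT, rfl⟩
    · exact fun T hT => (gramMinor_coedgeFinset f ((Set.Finite.mem_toFinset _).mp hT)).symm
  rw [det_dualLaplacian_eq_sum_gramMinor, ← hsum, Finset.sum_const, nsmul_one,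
    Set.ncard_eq_toFinset_card]

end SpanningTree

end Flow

end CycleChipFiring

theorem proposition3p9 {V : Type*} [Fintype V] [DecidableEq V] (G : SimpleGraph V)
    [DecidableRel G.Adj] (hG : G.Connected) (o : CycleChipFiring.Orientation G) (g : ℕ)
    (f : Module.Basis (Fin g) ℤ o.flow) (hf : CycleChipFiring.IsCycleMBasis f) :
    {c : Fin g → ℤ | CycleChipFiring.IsZSuperstable
        (CycleChipFiring.dualLaplacian f) c}.encard =
      (CycleChipFiring.spanningTrees G).encard := by
  rw [hf.encard_setOf_isZSuperstable, CycleChipFiring.det_dualLaplacian f hG, Int.natAbs_natCast,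
    (Set.toFinite _).cast_ncard_eq]
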